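/- Consider $n\ge 1$ anonymous, homogeneous, oblivious robots on the nodes of the infinite grid graph (the Cartesian product of two infinite paths, embedded in the plane with vertex set $\mathbb Z^2$), together with a finite set $M$ of meeting nodes. Each robot has its own local coordinate system along the grid lines, with its current position as origin; there is no agreement on orientation or chirality. Robots work in Look-Compute-Move cycles under a fair asynchronous scheduler. In the Look phase a robot sees, in its local coordinates, all meeting nodes and the exact number of robots on every node. In the Compute phase a deterministic algorithm, common to all robots, decides from this snapshot alone to stay or to move to an adjacent node. The move is instantaneous and happens at a later time chosen by the scheduler. Initially no move is pending, and in an initial configuration $C(0)$ the robots are on pairwise distinct nodes. A Weber node of a configuration is a meeting node that minimizes, among all meeting nodes, the sum of the grid distances from all robots. Let $W$ be the set of Weber nodes of $C(0)$. Gathering over Weber nodes can be solved from $C(0)$ if there is an algorithm that, for all choices of the local coordinate systems and in every fair asynchronous execution from $C(0)$, brings all robots within finite time to one node $m\in W$, where they remain. Let $\mathcal U$ be the set of initial configurations from which gathering over Weber nodes cannot be solved. A symmetry of $M$ is an automorphism of the grid that maps $M$ onto itself; a symmetry of a configuration is one that moreover preserves the number of robots on every node. The symmetries that matter are reflections in a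 line $l$ of the plane and rotations by $90^\circ$ or $180^\circ$ about a point $c$ of the plane. Define the following classes of initial configurations. * $\mathcal I_3^{b3}$: $|W|\ge 2$, $M$ has a unique line of symmetry $l$, the configuration is symmetric with respect to $l$, and no Weber node and no robot lies on $l$. * $\mathcal I_3^{b4}$: $|W|\ge 2$, $M$ has a unique line of symmetry $l$, the configuration is symmetric with respect to $l$, and no meeting node and no robot lies on $l$. * $\mathcal I_4^{b3}$: $|W|\ge 2$, $M$ has a rotational symmetry with centre $c$, the configuration has a rotational symmetry with centre $c$, and $c$ is neither a meeting node nor the position of a robot. Then: 1. If $C(0)\in \mathcal I_3^{b3}\cup\mathcal I_4^{b3}$, then gathering over Weber nodes cannot be solved from $C(0)$, that is, $\mathcal I_3^{b3}\cup\mathcal I_4^{b3}\subseteq\mathcal U$. 2. Likewise $\mathcal I_3^{b4}\subseteq\mathcal U$. 3. Consequently $\mathcal U$ includes all initial configurations that admit a single line of symmetry $l$ with no robot and no Weber node on $l$, and all initial configurations that admit a rotational symmetry with centre $c$ where $c$ is neither a meeting node nor the position of a robot. -/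

import Mathlib

noncomputable section

/-- The nodes of the infinite grid. -/
abbrev Node : Type := ℤ × ℤ

/-- The infinite grid: the Cartesian product of two copies of the infinite path on `ℤ`. -/
def gridGraph : SimpleGraph Node := SimpleGraph.boxProd (SimpleGraph.hasse ℤ) (SimpleGraph.hasse ℤ)

/-- Automorphisms of the grid graph. -/
abbrev GridAut : Type := gridGraph ≃g gridGraph

/-! ### Symmetries -/

/-- The embedding of the grid in the Cartesian plane (the plane is `ℂ`). -/
def toPlane (v : Node) : ℂ := ⟨(v.1 : ℝ), (v.2 : ℝ)⟩

/-- `φ` is the restriction to the grid of the reflection of the plane in the line `l`. -/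
def IsReflectionIn (φ : GridAut) (l : AffineSubspace ℝ ℂ) : Prop :=
  Module.finrank ℝ l.direction = 1 ∧
    ∃ _ : Nonempty l, ∀ v, toPlane (φ v) = EuclideanGeometry.reflection l (toPlane v)

/-- `φ` is the restriction to the grid of the rotation of the plane about `c` by `90°` or `180°`. -/
def IsRotationAbout (φ : GridAut) (c : ℂ) : Prop :=
  ∃ ω : ℂ, (ω = Complex.I ∨ ω = -1) ∧ ∀ v, toPlane (φ v) = c + ω * (toPlane v - c)

/-- The automorphism `φ` of the grid preserves the set `M` of nodes. -/
def PreservesNodes (φ : GridAut) (M : Finset Node) : Prop := ∀ v, φ v ∈ M ↔ v ∈ M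

/-- `l` is a line of symmetry of the set `M` of nodes. -/
def IsSymmetryLine (M : Finset Node) (l : AffineSubspace ℝ ℂ) : Prop :=
  ∃ φ : GridAut, IsReflectionIn φ l ∧ PreservesNodes φ M

/-- The set `M` of nodes admits a rotational symmetry with centre `c`. -/
def IsRotationCentre (M : Finset Node) (c : ℂ) : Prop :=
  ∃ φ : GridAut, IsRotationAbout φ c ∧ PreservesNodes φ M

/-! ### Configurations -/

/-- A configuration of `n` robots (several robots may share a node) and a finite set of
meeting nodes. -/
structure Configuration (n : ℕ) where
  /-- the position of each robot -/
  robots : Fin n → Node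
  /-- the set of meeting nodes -/
  meeting : Finset Node

namespace Configuration

variable {n : ℕ}

/-- The number of robots on the node `v`. -/
def count (C : Configuration n) (v : Node) : ℕ := (Finset.univ.filter fun i => C.robots i = v).card

/-- In an initial configuration the robots are on distinct nodes. -/
def IsInitial (C : Configuration n) : Prop := Function.Injective C.robots

/-- The consistency of a node: the sum of its grid distances from all the robots. -/
def consistency (C : Configuration n) (m : Node) : ℕ := ∑ i, gridGraph.dist (C.robots i) m

/-- The Weber nodes: the meeting nodes of minimum consistency. -/
def weberNodes (C : Configuration n) : Finset Node :=
  C.meeting.filter fun m => ∀ m' ∈ C.meeting, C.consistency m ≤ C.consistency m'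

/-- An automorphism of a configuration preserves the meeting nodes and the number of robots
on every node. -/
def IsAutomorphism (C : Configuration n) (φ : GridAut) : Prop :=
  PreservesNodes φ C.meeting ∧ ∀ v, C.count (φ v) = C.count v

/-- The configuration is symmetric with respect to the line `l`. -/
def IsSymmetricIn (C : Configuration n) (l : AffineSubspace ℝ ℂ) : Prop :=
  ∃ φ : GridAut, IsReflectionIn φ l ∧ C.IsAutomorphism φ

/-- The configuration has a rotational symmetry with centre `c`. -/
def IsRotationallySymmetric (C : Configuration n) (c : ℂ) : Prop :=
  ∃ φ : GridAut, IsRotationAbout φ c ∧ C.IsAutomorphism φ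

/-- No robot lies on the set `s` of points of the plane. -/
def NoRobotOn (C : Configuration n) (s : Set ℂ) : Prop := ∀ i, toPlane (C.robots i) ∉ s

/-- No meeting node lies on `s`. -/
def NoMeetingNodeOn (C : Configuration n) (s : Set ℂ) : Prop := ∀ m ∈ C.meeting, toPlane m ∉ s

/-- No Weber node lies on `s`. -/
def NoWeberNodeOn (C : Configuration n) (s : Set ℂ) : Prop := ∀ m ∈ C.weberNodes, toPlane m ∉ s

end Configuration

/-! ### Classes of initial configurations -/

/-- `I₃ᵇ` with line of symmetry `l`: there are at least two Weber nodes, `l` is the unique line of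
symmetry of the meeting nodes, and the whole configuration is symmetric in `l`. -/
def InI3b {n : ℕ} (C : Configuration n) (l : AffineSubspace ℝ ℂ) : Prop :=
  C.IsInitial ∧ 2 ≤ C.weberNodes.card ∧
    (IsSymmetryLine C.meeting l ∧ ∀ l', IsSymmetryLine C.meeting l' → l' = l) ∧
    C.IsSymmetricIn l

/-- `I₃ᵇ³`: no robot and no Weber node on the line of symmetry. -/
def classI3b3 (n : ℕ) : Set (Configuration n) :=
  {C | ∃ l, InI3b C l ∧ C.NoWeberNodeOn l ∧ C.NoRobotOn l}

/-- `I₃ᵇ⁴`: no robot and no meeting node on the line of symmetry. -/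
def classI3b4 (n : ℕ) : Set (Configuration n) :=
  {C | ∃ l, InI3b C l ∧ C.NoMeetingNodeOn l ∧ C.NoRobotOn l}

/-- `I₄ᵇ` with centre `c`: there are at least two Weber nodes, and the meeting nodes as well as the
whole configuration have a rotational symmetry with centre `c`. -/
def InI4b {n : ℕ} (C : Configuration n) (c : ℂ) : Prop :=
  C.IsInitial ∧ 2 ≤ C.weberNodes.card ∧ IsRotationCentre C.meeting c ∧ C.IsRotationallySymmetric c

/-- `I₄ᵇ³`: no robot and no meeting node at the centre. -/
def classI4b3 (n : ℕ) : Set (Configuration n) :=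
  {C | ∃ c, InI4b C c ∧ C.NoMeetingNodeOn {c} ∧ C.NoRobotOn {c}}

/-- The initial configurations that admit a single line of symmetry `l`, with no robot and no Weber
node on `l`. -/
def singleLineFamily (n : ℕ) : Set (Configuration n) :=
  {C | C.IsInitial ∧ ∃ l, (C.IsSymmetricIn l ∧ ∀ l', C.IsSymmetricIn l' → l' = l) ∧
    C.NoRobotOn l ∧ C.NoWeberNodeOn l}

/-- The initial configurations that admit a rotational symmetry, with no robot and no meeting node
at its centre `c`. -/
def rotationalFamily (n : ℕ) : Set (Configuration n) :=
  {C | C.IsInitial ∧ ∃ c, C.IsRotationallySymmetric c ∧ C.NoRobotOn {c} ∧ C.NoMeetingNodeOn {c}}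

/-! ### Robots -/

/-- The orientation of a local coordinate system: a linear automorphism of the grid, that is, one of
the eight ways to choose the directions of the two axes along the grid lines. There is no common
orientation and no common chirality. -/
structure LocalFrame where
  /-- the passage from global to local directions -/
  toLocal : Node ≃+ Node
  /-- it respects the edges of the grid -/
  adj_iff : ∀ u v, gridGraph.Adj (toLocal u) (toLocal v) ↔ gridGraph.Adj u v

/-- What a robot sees, in local coordinates with the robot at the origin: the meeting nodes, and the
exact number of robots on every node (global strong multiplicity detection). -/
structure Snapshot where
  /-- the meeting nodes -/
  meeting : Set Node
  /-- the number of robots on every node -/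
  count : Node → ℕ

/-- A deterministic distributed algorithm. All robots execute the same function, which depends on the
current snapshot only (the robots are anonymous, homogeneous and oblivious). Its value, in local
coordinates, is the origin (stay idle) or a neighbour of the origin. -/
structure Algorithm where
  /-- the computed destination -/
  dest : Snapshot → Node
  /-- the robot stays or goes to an adjacent node -/
  dest_spec : ∀ s, dest s = 0 ∨ gridGraph.Adj 0 (dest s)

/-- The snapshot of the configuration `C` taken by a robot at the node `p` with frame `F`. The node
with local coordinates `u` is the node `p + F.toLocal.symm u` of the grid. -/
def snapshot {n : ℕ} (C : Configuration n) (F : LocalFrame) (p : Node) : Snapshot where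
  meeting := {u | p + F.toLocal.symm u ∈ C.meeting}
  count := fun u => C.count (p + F.toLocal.symm u)

/-- The node of the grid that a robot at `p` with frame `F` computes as its destination. -/
def computedDest {n : ℕ} (A : Algorithm) (C : Configuration n) (F : LocalFrame) (p : Node) : Node :=
  p + F.toLocal.symm (A.dest (snapshot C F p))

/-- An execution of the algorithm `A` from the initial configuration `C` under a fair asynchronous
scheduler, for robots with local frames `F`. A robot alternates between taking a snapshot with
computing a destination, and an instantaneous move to this destination. These events happen at
arbitrary times, so the destination may rest on an outdated snapshot when the robot moves. -/
structure AsyncExecution {n : ℕ} (A : Algorithm) (F : Fin n → LocalFrame)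
    (C : Configuration n) where
  /-- the positions of the robots at every time -/
  pos : ℕ → Fin n → Node
  /-- the destination of the pending move of every robot; `none` if no move is pending -/
  pending : ℕ → Fin n → Option Node
  /-- the execution starts from the configuration `C` -/
  pos_zero : pos 0 = C.robots
  /-- initially no move is pending -/
  pending_zero : ∀ i, pending 0 i = none
  /-- at every time a robot does nothing, or looks and computes, or moves -/
  step : ∀ t i,
    (pos (t + 1) i = pos t i ∧ pending (t + 1) i = pending t i) ∨
    (pending t i = none ∧ pos (t + 1) i = pos t i ∧
      pending (t + 1) i = some (computedDest A ⟨pos t, C.meeting⟩ (F i) (pos t i))) ∨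
    (∃ v, pending t i = some v ∧ pos (t + 1) i = v ∧ pending (t + 1) i = none)
  /-- fairness: every robot completes infinitely many cycles -/
  fair : ∀ i t, ∃ t', t ≤ t' ∧ pending t' i ≠ none ∧ pending (t' + 1) i = none

/-- Gathering over Weber nodes can be solved from the initial configuration `C`: some algorithm, for
all local frames of the robots and in every fair asynchronous execution, brings all robots to one of
the Weber nodes of `C` within finite time, where they remain. -/
def GatheringOverWeberNodesSolvable {n : ℕ} (C : Configuration n) : Prop :=
  ∃ A : Algorithm, ∀ (F : Fin n → LocalFrame) (e : AsyncExecution A F C),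
    ∃ m ∈ C.weberNodes, ∃ T, ∀ t, T ≤ t → ∀ i, e.pos t i = m

/-- The set `U` of the initial configurations from which gathering over Weber nodes cannot be
solved. -/
def unsolvableConfigurations (n : ℕ) : Set (Configuration n) :=
  {C | C.IsInitial ∧ ¬ GatheringOverWeberNodesSolvable C}

end

/-!
A reflection of the plane in a line, as well as a half-turn (the reflection in a point), restricts
to an involutive symmetry `φ` of the grid. If `φ` preserves the configuration and fixes no robot, it
pairs the robots off; give the two members of a pair local frames that are mirror images of each
other under `φ`. Then both see the same snapshot, so when all robots look and move in lockstep the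
configuration stays symmetric under `φ` for ever, and the robots can only gather at a node fixed by
`φ`. Such a node lies on the mirror, hence is not a Weber node. A quarter-turn is reduced to a
half-turn by squaring it.
-/

theorem toPlane_injective : Function.Injective toPlane := fun u v h => by
  have hre : (u.1 : ℝ) = v.1 := congrArg Complex.re h
  have him : (u.2 : ℝ) = v.2 := congrArg Complex.im h
  exact Prod.ext (by exact_mod_cast hre) (by exact_mod_cast him)

theorem toPlane_add (u v : Node) : toPlane (u + v) = toPlane u + toPlane v := by
  apply Complex.ext <;> simp [toPlane]

theorem toPlane_sub (u v : Node) : toPlane (u - v) = toPlane u - toPlane v := by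
  apply Complex.ext <;> simp [toPlane]

theorem gridGraph_adj_add_right (a u v : Node) :
    gridGraph.Adj (u + a) (v + a) ↔ gridGraph.Adj u v := by
  simp only [gridGraph, SimpleGraph.boxProd_adj, SimpleGraph.hasse_adj, Order.covBy_iff_add_one_eq,
    Prod.fst_add, Prod.snd_add, add_right_comm _ _ (1 : ℤ), add_left_inj]

namespace GridAut

/-- `L` is the linear part of the automorphism `φ` of the grid, which makes `φ` an affine map of
`ℤ²`. It is recorded as a `LocalFrame`, so that it can serve as the orientation of a robot. -/
def HasLinearPart (φ : GridAut) (L : LocalFrame) : Prop := ∀ u v, φ (u + v) = φ u + L.toLocal v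

theorem exists_hasLinearPart {φ : GridAut} (h : ∀ u v, φ (u + v) - φ u = φ v - φ 0) :
    ∃ L, φ.HasLinearPart L := by
  let f : Node →+ Node := AddMonoidHom.mk' (fun v => φ v - φ 0) fun u v => by
    rw [← h u v]; abel
  have hf : Function.Bijective f := (Equiv.subRight (φ 0)).bijective.comp φ.bijective
  refine ⟨⟨AddEquiv.ofBijective f hf, fun u v => ?_⟩, fun u v => eq_add_of_sub_eq' (h u v)⟩
  change gridGraph.Adj (φ u - φ 0) (φ v - φ 0) ↔ _
  rw [← gridGraph_adj_add_right (φ 0), sub_add_cancel, sub_add_cancel]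
  exact φ.map_adj_iff

theorem exists_hasLinearPart_of_toPlane {φ : GridAut} {g : ℂ →ᵃ[ℝ] ℂ}
    (h : ∀ v, toPlane (φ v) = g (toPlane v)) : ∃ L, φ.HasLinearPart L := by
  have map_increment (u v : Node) : toPlane (φ (u + v) - φ u) = g.linear (toPlane v) := by
    rw [toPlane_sub, h, h, ← vsub_eq_sub, ← g.linearMap_vsub, toPlane_add, vsub_eq_sub,
      add_sub_cancel_left]
  refine exists_hasLinearPart fun u v => toPlane_injective ?_
  rw [map_increment, ← map_increment 0 v, zero_add]

theorem HasLinearPart.involutive {φ : GridAut} {L : LocalFrame} (hL : φ.HasLinearPart L)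
    (hφ : Function.Involutive φ) : Function.Involutive L.toLocal := fun v => by
  have h : φ (φ 0) + L.toLocal (L.toLocal v) = φ (φ (0 + v)) := by rw [hL, hL]
  rwa [hφ, hφ, add_right_inj] at h

end GridAut

/-- The coordinate system with the global orientation. -/
def LocalFrame.refl : LocalFrame where
  toLocal := AddEquiv.refl Node
  adj_iff _ _ := Iff.rfl

namespace Configuration

variable {n : ℕ} {C : Configuration n} {φ : GridAut}

theorem IsAutomorphism.trans {ψ : GridAut} (hφ : C.IsAutomorphism φ) (hψ : C.IsAutomorphism ψ) :
    C.IsAutomorphism (φ.trans ψ) :=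
  ⟨fun v => (hψ.1 (φ v)).trans (hφ.1 v), fun v => (hψ.2 (φ v)).trans (hφ.2 v)⟩

theorem isAutomorphism_of_perm (hM : PreservesNodes φ C.meeting) {σ : Equiv.Perm (Fin n)}
    (hσ : ∀ i, C.robots (σ i) = φ (C.robots i)) : C.IsAutomorphism φ :=
  ⟨hM, fun _ => (Finset.card_equiv σ fun _ => by
    simp only [Finset.mem_filter, Finset.mem_univ, true_and, hσ,
      EmbeddingLike.apply_eq_iff_eq]).symm⟩

theorem IsAutomorphism.exists_robots_eq (hA : C.IsAutomorphism φ) (i : Fin n) :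
    ∃ j, C.robots j = φ (C.robots i) := by
  have count_pos : 0 < C.count (φ (C.robots i)) := by
    rw [hA.2]
    exact Finset.card_pos.mpr ⟨i, Finset.mem_filter.mpr ⟨Finset.mem_univ i, rfl⟩⟩
  obtain ⟨j, hj⟩ := Finset.card_pos.mp count_pos
  exact ⟨j, (Finset.mem_filter.mp hj).2⟩

theorem IsAutomorphism.exists_involutive_perm (hC : C.IsInitial) (hφ : Function.Involutive φ)
    (hA : C.IsAutomorphism φ) : ∃ σ : Equiv.Perm (Fin n),
      Function.Involutive σ ∧ ∀ i, C.robots (σ i) = φ (C.robots i) := by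
  choose σ hσ using hA.exists_robots_eq
  have hinv : Function.Involutive σ := fun i => hC (by rw [hσ, hσ, hφ])
  exact ⟨hinv.toPerm σ, hinv, hσ⟩

theorem NoMeetingNodeOn.noWeberNodeOn {s : Set ℂ} (h : C.NoMeetingNodeOn s) :
    C.NoWeberNodeOn s :=
  fun m hm => h m (Finset.mem_filter.mp hm).1

end Configuration

theorem classI3b4_subset_classI3b3 (n : ℕ) : classI3b4 n ⊆ classI3b3 n :=
  fun _ ⟨l, hl, hM, hR⟩ => ⟨l, hl, hM.noWeberNodeOn, hR⟩

theorem classI3b3_subset_singleLineFamily (n : ℕ) : classI3b3 n ⊆ singleLineFamily n :=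
  fun _ ⟨l, ⟨hC, _, ⟨_, hunique⟩, hl⟩, hW, hR⟩ =>
    ⟨hC, l, ⟨hl, fun l' ⟨φ, hφ, hA⟩ => hunique l' ⟨φ, hφ, hA.1⟩⟩, hR, hW⟩

theorem classI4b3_subset_rotationalFamily (n : ℕ) : classI4b3 n ⊆ rotationalFamily n :=
  fun _ ⟨c, ⟨hC, _, _, hc⟩, hM, hR⟩ => ⟨hC, c, hc, hR, hM⟩

/-- `φ` is the restriction to the grid of the reflection of the plane in the affine subspace `s`.
For a line `s` this is the reflection in the line, for a point it is the half-turn about it. -/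
def IsReflectionThrough (φ : GridAut) (s : AffineSubspace ℝ ℂ) : Prop :=
  ∃ _ : Nonempty s, ∀ v, toPlane (φ v) = EuclideanGeometry.reflection s (toPlane v)

namespace IsReflectionThrough

variable {φ : GridAut} {s : AffineSubspace ℝ ℂ}

theorem involutive (h : IsReflectionThrough φ s) : Function.Involutive φ := by
  obtain ⟨_, h⟩ := h
  exact fun v => toPlane_injective (by rw [h, h, EuclideanGeometry.reflection_reflection])

theorem exists_hasLinearPart (h : IsReflectionThrough φ s) : ∃ L, φ.HasLinearPart L := by
  obtain ⟨_, h⟩ := h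
  exact GridAut.exists_hasLinearPart_of_toPlane
    (g := (EuclideanGeometry.reflection s).toAffineEquiv.toAffineMap) h

theorem mem_of_map_eq (h : IsReflectionThrough φ s) {v : Node} (hv : φ v = v) :
    toPlane v ∈ s := by
  obtain ⟨_, h⟩ := h
  rw [← EuclideanGeometry.reflection_eq_self_iff, ← h, hv]

end IsReflectionThrough

theorem isReflectionThrough_affineSpan_singleton {φ : GridAut} {c : ℂ}
    (h : ∀ v, toPlane (φ v) = 2 * c - toPlane v) :
    IsReflectionThrough φ (affineSpan ℝ {c}) := by
  refine ⟨inferInstance, fun v => ?_⟩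
  rw [h, EuclideanGeometry.reflection_apply',
    EuclideanGeometry.orthogonalProjection_affineSpan_singleton, vsub_eq_sub, vadd_eq_add]
  ring

theorem Configuration.IsRotationallySymmetric.exists_isReflectionThrough {n : ℕ}
    {C : Configuration n} {c : ℂ} (h : C.IsRotationallySymmetric c) :
    ∃ φ, IsReflectionThrough φ (affineSpan ℝ {c}) ∧ C.IsAutomorphism φ := by
  obtain ⟨φ, ⟨ω, rfl | rfl, hφ⟩, hA⟩ := h
  · refine ⟨φ.trans φ, isReflectionThrough_affineSpan_singleton fun v => ?_, hA.trans hA⟩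
    rw [RelIso.trans_apply, hφ, hφ]
    linear_combination (toPlane v - c) * Complex.I_mul_I
  · exact ⟨φ, isReflectionThrough_affineSpan_singleton fun v => by rw [hφ]; ring, hA⟩

/-- The initial configurations that are symmetric under the reflection in some affine subspace, such
as a line or a point, which contains no robot and no Weber node. -/
def reflectiveFamily (n : ℕ) : Set (Configuration n) :=
  {C | C.IsInitial ∧ ∃ s, (∃ φ, IsReflectionThrough φ s ∧ C.IsAutomorphism φ) ∧
    C.NoRobotOn s ∧ C.NoWeberNodeOn s}

theorem singleLineFamily_subset_reflectiveFamily (n : ℕ) :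
    singleLineFamily n ⊆ reflectiveFamily n :=
  fun _ ⟨hC, l, ⟨⟨φ, hφ, hA⟩, _⟩, hR, hW⟩ => ⟨hC, l, ⟨φ, hφ.2, hA⟩, hR, hW⟩

theorem rotationalFamily_subset_reflectiveFamily (n : ℕ) :
    rotationalFamily n ⊆ reflectiveFamily n := by
  rintro C ⟨hC, c, hc, hR, hM⟩
  refine ⟨hC, affineSpan ℝ {c}, hc.exists_isReflectionThrough, ?_⟩
  rw [AffineSubspace.coe_affineSpan_singleton]
  exact ⟨hR, hM.noWeberNodeOn⟩

section Symmetry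

variable {n : ℕ} {C : Configuration n} {φ : GridAut} {L F F' : LocalFrame}

theorem snapshot_map (hL : φ.HasLinearPart L) (hA : C.IsAutomorphism φ)
    (hF : ∀ u, F'.toLocal.symm u = L.toLocal (F.toLocal.symm u)) (p : Node) :
    snapshot C F' (φ p) = snapshot C F p := by
  simp only [snapshot, hF, ← hL p, hA.1 _, hA.2]

theorem computedDest_map (A : Algorithm) (hL : φ.HasLinearPart L) (hA : C.IsAutomorphism φ)
    (hF : ∀ u, F'.toLocal.symm u = L.toLocal (F.toLocal.symm u)) (p : Node) :
    computedDest A C F' (φ p) = φ (computedDest A C F p) := by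
  rw [computedDest, snapshot_map hL hA hF, hF, ← hL, computedDest]

end Symmetry

section Synchronous

variable {n : ℕ} (A : Algorithm) (F : Fin n → LocalFrame) (C : Configuration n)

/-- The positions of the robots after every round of the fully synchronous execution, in which all
robots look simultaneously and then move simultaneously. -/
def syncPos : ℕ → Fin n → Node
  | 0 => C.robots
  | k + 1 => fun i => computedDest A ⟨syncPos k, C.meeting⟩ (F i) (syncPos k i)

/-- The fully synchronous execution as a fair asynchronous one: all robots look at even times and
move at odd times. -/
def syncExecution : AsyncExecution A F C where
  pos t := syncPos A F C (t / 2)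
  pending t i := if Even t then none else some (syncPos A F C (t / 2 + 1) i)
  pos_zero := rfl
  pending_zero _ := if_pos Even.zero
  step t i := by
    right
    rcases Nat.even_or_odd t with ht | ht
    · have hdiv : (t + 1) / 2 = t / 2 := by grind
      have hodd : ¬ Even (t + 1) := Nat.not_even_iff_odd.mpr ht.add_one
      exact .inl ⟨if_pos ht, by rw [hdiv], by rw [if_neg hodd, hdiv, syncPos]⟩
    · have hdiv : (t + 1) / 2 = t / 2 + 1 := by grind
      exact .inr ⟨_, if_neg (Nat.not_even_iff_odd.mpr ht), by rw [hdiv], if_pos ht.add_one⟩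
  fair i t := ⟨2 * t + 1, by lia, by simp, by simp [Nat.even_add_one]⟩

variable {F C}

theorem syncPos_map {φ : GridAut} {L : LocalFrame} (hL : φ.HasLinearPart L)
    (hM : PreservesNodes φ C.meeting) {σ : Equiv.Perm (Fin n)}
    (hσ : ∀ i, C.robots (σ i) = φ (C.robots i))
    (hF : ∀ i u, (F (σ i)).toLocal.symm u = L.toLocal ((F i).toLocal.symm u))
    (k : ℕ) (i : Fin n) : syncPos A F C k (σ i) = φ (syncPos A F C k i) := by
  induction k generalizing i with
  | zero => exact hσ i
  | succ k ih =>
    have hA : Configuration.IsAutomorphism ⟨syncPos A F C k, C.meeting⟩ φ :=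
      Configuration.isAutomorphism_of_perm hM ih
    simp only [syncPos, ih]
    exact computedDest_map A hL hA (hF i) _

end Synchronous

theorem LocalFrame.exists_equivariant {ι : Type*} [LinearOrder ι] {L : LocalFrame}
    (hL : Function.Involutive L.toLocal) {σ : ι → ι} (hσ : Function.Involutive σ)
    (hfix : ∀ i, σ i ≠ i) : ∃ F : ι → LocalFrame,
      ∀ i u, (F (σ i)).toLocal.symm u = L.toLocal ((F i).toLocal.symm u) := by
  -- The order of the indices selects one element of each pair `{i, σ i}`.
  refine ⟨fun i => if i < σ i then LocalFrame.refl else L, fun i u => ?_⟩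
  rcases lt_or_gt_of_ne (hfix i) with hi | hi
  · simp only [hσ i, hi, not_lt_of_gt hi, if_true, if_false]
    exact (L.toLocal.apply_symm_apply u).symm
  · simp only [hσ i, hi, not_lt_of_gt hi, if_true, if_false]
    exact L.toLocal.symm_apply_eq.mpr (hL u).symm

theorem not_gatheringOverWeberNodesSolvable_of_involutive {n : ℕ} (hn : 1 ≤ n)
    {C : Configuration n} (hC : C.IsInitial) {φ : GridAut} {L : LocalFrame}
    (hL : φ.HasLinearPart L) (hφ : Function.Involutive φ) (hA : C.IsAutomorphism φ)
    (hR : ∀ i, φ (C.robots i) ≠ C.robots i) (hW : ∀ m ∈ C.weberNodes, φ m ≠ m) :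
    ¬ GatheringOverWeberNodesSolvable C := by
  rintro ⟨A, hsolve⟩
  obtain ⟨σ, hσ, hrobots⟩ := hA.exists_involutive_perm hC hφ
  have hfix : ∀ i, σ i ≠ i := fun i hi => hR i (by rw [← hrobots, hi])
  obtain ⟨F, hF⟩ := LocalFrame.exists_equivariant (hL.involutive hφ) hσ hfix
  obtain ⟨m, hm, T, hT⟩ := hsolve F (syncExecution A F C)
  have gathered (i : Fin n) : syncPos A F C (T / 2) i = m := hT T le_rfl i
  have symmetric := syncPos_map A hL hA.1 hrobots hF (T / 2) ⟨0, hn⟩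
  rw [gathered, gathered] at symmetric
  exact hW m hm symmetric.symm

theorem mainTheorem2_general (n : ℕ) (hn : 1 ≤ n) :
    reflectiveFamily n ⊆ unsolvableConfigurations n := by
  rintro C ⟨hC, s, ⟨φ, hφ, hA⟩, hR, hW⟩
  obtain ⟨L, hL⟩ := hφ.exists_hasLinearPart
  exact ⟨hC, not_gatheringOverWeberNodesSolvable_of_involutive hn hC hL hφ.involutive hA
    (fun i hi => hR i (hφ.mem_of_map_eq hi)) fun m hm hi => hW m hm (hφ.mem_of_map_eq hi)⟩

theorem mainTheorem2 (n : ℕ) (hn : 1 ≤ n) :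
    classI3b3 n ∪ classI4b3 n ⊆ unsolvableConfigurations n ∧
    classI3b4 n ⊆ unsolvableConfigurations n ∧
    singleLineFamily n ∪ rotationalFamily n ⊆ unsolvableConfigurations n := by
  have families_subset := (Set.union_subset (singleLineFamily_subset_reflectiveFamily n)
    (rotationalFamily_subset_reflectiveFamily n)).trans (mainTheorem2_general n hn)
  have classes_subset := (Set.union_subset_union (classI3b3_subset_singleLineFamily n)
    (classI4b3_subset_rotationalFamily n)).trans families_subset
  exact ⟨classes_subset, (classI3b4_subset_classI3b3 n).trans
    (Set.subset_union_left.trans classes_subset), families_subset⟩
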